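/- A (finite) merge tree is a pair $(T,f)$ of a finite rooted tree $T$ with vertex set $V(T)$ and a function $f:V(T)\to\mathbb R\cup\{\infty\}$ such that adjacent vertices have different values, every non-root vertex has exactly one neighbour with a higher value, and the root has degree one and is the only vertex with value $\infty$. The leaves are the non-root vertices of degree one. Let $|T|$ be the associated metric tree without the root (which lies at infinite height): the edge from a vertex $v$ up to its higher neighbour $p$ is a copy of the interval of heights from $f(v)$ to $f(p)$, which extends $f$ to $|T|$, and $|T|$ carries the path metric in which the length of a monotone path is the difference of the $f$-values of its ends. The points of $|T|$ are partially ordered by $x\preceq y$ if $y$ is an ancestor of $x$ or equal to it; $\mathrm{LCA}$ denotes the lowest common ancestor, and $\mathrm{depth}(w)=\sup_{u\preceq w}(f(w)-f(u))$. For merge trees $(T,f),(T',f')$ and $\delta\in\mathbb R$, a $\delta$-good map is a continuous map $\alpha:|T|\to|T'|$ such that (i) $f'(\alpha(x))-f(x)=\delta$ for all $x\in|T|$; (ii) for every $w\in\mathrm{Im}(\alpha)$, with $x'=\mathrm{LCA}(\alpha^{-1}(w))$, one has $f(x')-f(u)\le 2\delta$ for all $u\in\alpha^{-1}(w)$; (iii)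 $\mathrm{depth}(w)\le 2\delta$ for every $w\in|T'|\setminus\mathrm{Im}(\alpha)$. The interleaving distance is $$d_I((T,f),(T',f'))=\inf\{\delta : \text{there is a } \delta\text{-good map } |T|\to|T'|\}.$$ A labelling of $(T,f)$ by $[n]=\{1,\dots,n\}$ is a map $\pi$ from $[n]$ to the non-root vertices of $T$ whose image contains every leaf; its induced matrix is $\mathcal M(T,f,\pi)_{ij}=f(\mathrm{LCA}(\pi(i),\pi(j)))$. The labelled interleaving distance of two merge trees labelled by the same $[n]$ is $d_I^L((T,f,\pi),(T',f',\pi'))=\max_{i,j}|\mathcal M(T,f,\pi)_{ij}-\mathcal M(T',f',\pi')_{ij}|$. Merge trees are considered up to subdivision of edges, where a new vertex on an edge gets a value strictly between those of the ends of the edge. Corollary. For any two finite merge trees $(T,f)$ and $(T',f')$ there exist an $n$, subdivisions $(S,g)$ of $(T,f)$ and $(S',g')$ of $(T',f')$, and labellings $\pi$ of $(S,g)$ and $\pi'$ of $(S',g')$ by $[n]$ such that $$d_I((T,f),(T',f'))=d_I^L((S,g,\pi),(S',g',\pi')).$$ Moreover the interleaving distance is attained: there is a $\delta$-good map $\alpha:|T|\to|T'|$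 with $\delta=d_I((T,f),(T',f'))$. -/

import Mathlib

universe u u'

/-- A (finite) merge tree: a finite rooted tree with a height function with values in `ℝ ∪ {∞}`,
such that adjacent vertices have different heights, every non-root vertex has exactly one higher
neighbour, and the root has degree one and is the only vertex of height `∞`. -/
structure MergeTree where
  /-- the vertex set -/
  V : Type u
  [finite : Finite V]
  /-- the underlying graph -/
  G : SimpleGraph V
  /-- the root -/
  root : V
  /-- the height function -/
  f : V → WithTop ℝ
  isTree : G.IsTree
  adj_ne : ∀ v w, G.Adj v w → f v ≠ f w
  exists_unique_higher : ∀ v, v ≠ root → ∃! w, G.Adj v w ∧ f v < f w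
  root_degree : (G.neighborSet root).ncard = 1
  eq_top_iff : ∀ v, f v = ⊤ ↔ v = root

namespace MergeTree

/-- A leaf is a non-root vertex of degree one. -/
def IsLeaf (T : MergeTree.{u}) (v : T.V) : Prop :=
  v ≠ T.root ∧ (T.G.neighborSet v).ncard = 1

/-- `T.Anc v w` says that `w` is an ancestor of `v` or equal to it: there is a path from `v` to `w`
along which the height is strictly increasing. -/
def Anc (T : MergeTree.{u}) (v w : T.V) : Prop :=
  Relation.ReflTransGen (fun a b => T.G.Adj a b ∧ T.f a < T.f b) v w

theorem Anc.le {T : MergeTree.{u}} {v w : T.V} (h : T.Anc v w) : T.f v ≤ T.f w := by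
  unfold Anc at h
  induction h with
  | refl => exact le_rfl
  | tail _ hbc ih => exact ih.trans hbc.2.le

theorem Anc.antisymm {T : MergeTree.{u}} {v w : T.V} (h : T.Anc v w) (h' : T.Anc w v) :
    v = w := by
  have hle := Anc.le h'
  unfold Anc at h
  rcases Relation.ReflTransGen.cases_head h with h1 | ⟨c, hc, hcw⟩
  · exact h1
  · exact absurd (hc.2.trans_le (Anc.le hcw)) (not_lt.mpr hle)

theorem higher_unique (T : MergeTree.{u}) {v a b : T.V} (ha : T.G.Adj v a ∧ T.f v < T.f a)
    (hb : T.G.Adj v b ∧ T.f v < T.f b) : a = b := by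
  have hv : v ≠ T.root := by
    intro h
    rw [(T.eq_top_iff v).2 h] at ha
    exact not_top_lt ha.2
  exact (T.exists_unique_higher v hv).unique ha hb

theorem Anc.total {T : MergeTree.{u}} {v a b : T.V} (ha : T.Anc v a) (hb : T.Anc v b) :
    T.Anc a b ∨ T.Anc b a :=
  Relation.ReflTransGen.total_of_right_unique (fun _ _ _ h h' => T.higher_unique h h') ha hb

theorem anc_root (T : MergeTree.{u}) (v : T.V) : T.Anc v T.root := by
  have := T.finite
  have wf : WellFounded (fun a b : T.V => T.f b < T.f a) := by
    have : IsTrans T.V (fun a b : T.V => T.f b < T.f a) := ⟨fun _ _ _ h h' => h'.trans h⟩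
    have : Std.Irrefl (fun a b : T.V => T.f b < T.f a) := ⟨fun _ => lt_irrefl _⟩
    exact Finite.wellFounded_of_trans_of_irrefl _
  induction v using wf.induction with
  | _ v ih =>
    by_cases hv : v = T.root
    · subst hv
      exact Relation.ReflTransGen.refl
    · obtain ⟨w, hw, -⟩ := T.exists_unique_higher v hv
      exact Relation.ReflTransGen.head hw (ih w hw.2)

/-- Any two non-root vertices have a least common ancestor, which is not the root. -/
theorem exists_vertex_lca (T : MergeTree.{u}) {v w : T.V} (hv : v ≠ T.root) (hw : w ≠ T.root) :
    ∃ a, a ≠ T.root ∧ T.Anc v a ∧ T.Anc w a ∧ ∀ b, T.Anc v b → T.Anc w b → T.Anc a b := by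
  have := T.finite
  obtain ⟨c, hc⟩ := Set.ncard_eq_one.1 T.root_degree
  have key : ∀ x, x ≠ T.root → T.Anc x c := by
    intro x hx
    rcases Relation.ReflTransGen.cases_tail (T.anc_root x) with h | ⟨b, hxb, hb⟩
    · exact absurd h.symm hx
    · have hbc : b ∈ T.G.neighborSet T.root := hb.1.symm
      rw [hc, Set.mem_singleton_iff] at hbc
      exact hbc ▸ hxb
  have hcr : c ≠ T.root := by
    rintro rfl
    have h : T.root ∈ T.G.neighborSet T.root := by
      rw [hc]
      rfl
    exact T.G.loopless.irrefl _ h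
  obtain ⟨a, ha, hmin⟩ := Set.exists_min_image {a | T.Anc v a ∧ T.Anc w a} T.f
    (Set.toFinite _) ⟨c, key v hv, key w hw⟩
  have hleast : ∀ b, T.Anc v b → T.Anc w b → T.Anc a b := by
    intro b hb hb'
    rcases Anc.total ha.1 hb with h | h
    · exact h
    · unfold Anc at h
      rcases Relation.ReflTransGen.cases_head h with h1 | ⟨d, hd, hda⟩
      · rw [h1]
        exact Relation.ReflTransGen.refl
      · exact absurd (hmin b ⟨hb, hb'⟩) (not_le.mpr (hd.2.trans_le (Anc.le hda)))
  refine ⟨a, ?_, ha.1, ha.2, hleast⟩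
  rintro rfl
  have h := Anc.le (hleast c (key v hv) (key w hw))
  rw [(T.eq_top_iff _).2 rfl, top_le_iff] at h
  exact hcr ((T.eq_top_iff c).1 h)

/-- A point of the metric tree `|T|` (of finite height, i.e. other than the root). The edge from a
non-root vertex `v` up to its unique higher neighbour `p` is the half-open interval
`[f v, f p)` of heights; a point of `|T|` is a pair of such a `v` and a height in that interval. -/
@[ext]
structure Point (T : MergeTree.{u}) where
  /-- the lower end of the edge on which the point lies -/
  v : T.V
  /-- the height of the point -/
  height : ℝ
  ne_root : v ≠ T.root
  le_height : T.f v ≤ (height : WithTop ℝ)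
  height_lt : ∀ p, T.G.Adj v p → T.f v < T.f p → (height : WithTop ℝ) < T.f p

namespace Point

variable {T : MergeTree.{u}}

/-- `x ≤ y` says that `y` lies on the way from `x` up to the root. -/
instance : PartialOrder T.Point where
  le x y := T.Anc x.v y.v ∧ x.height ≤ y.height
  le_refl _ := ⟨Relation.ReflTransGen.refl, le_rfl⟩
  le_trans _ _ _ h h' := ⟨Relation.ReflTransGen.trans h.1 h'.1, h.2.trans h'.2⟩
  le_antisymm _ _ h h' := Point.ext (Anc.antisymm h.1 h'.1) (le_antisymm h.2 h'.2)

theorem le_iff {x y : T.Point} : x ≤ y ↔ T.Anc x.v y.v ∧ x.height ≤ y.height := Iff.rfl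

theorem height_lt_of_anc (x : T.Point) {a p : T.V} (h : T.Anc x.v a)
    (hp : T.G.Adj a p ∧ T.f a < T.f p) : (x.height : WithTop ℝ) < T.f p := by
  unfold Anc at h
  rcases Relation.ReflTransGen.cases_head h with h1 | ⟨d, hd, hda⟩
  · subst h1
    exact x.height_lt p hp.1 hp.2
  · exact (x.height_lt d hd.1 hd.2).trans_le ((Anc.le hda).trans hp.2.le)

theorem exists_isLUB_pair (x y : T.Point) : ∃ z, IsLUB {x, y} z := by
  obtain ⟨a, har, hva, hwa, hleast⟩ := T.exists_vertex_lca x.ne_root y.ne_root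
  obtain ⟨r, hr⟩ := WithTop.ne_top_iff_exists.1 (fun h => har ((T.eq_top_iff a).1 h))
  refine ⟨⟨a, max r (max x.height y.height), har, ?_, ?_⟩, ?_, ?_⟩
  · rw [← hr]
    exact WithTop.coe_le_coe.2 (le_max_left _ _)
  · intro p hp hlt
    rw [WithTop.coe_max, WithTop.coe_max]
    refine max_lt (hr ▸ hlt) (max_lt ?_ ?_)
    · exact x.height_lt_of_anc hva ⟨hp, hlt⟩
    · exact y.height_lt_of_anc hwa ⟨hp, hlt⟩
  · rintro z (rfl | rfl)
    · exact ⟨hva, (le_max_left _ _).trans (le_max_right _ _)⟩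
    · exact ⟨hwa, (le_max_right _ _).trans (le_max_right _ _)⟩
  · intro z hz
    have hx : x ≤ z := hz (by simp)
    have hy : y ≤ z := hz (by simp)
    have haz : T.Anc a z.v := hleast _ hx.1 hy.1
    refine ⟨haz, max_le ?_ (max_le hx.2 hy.2)⟩
    have h := (Anc.le haz).trans z.le_height
    rw [← hr] at h
    exact WithTop.coe_le_coe.1 h

/-- The lowest common ancestor of two points of `|T|` is their supremum `x ⊔ y`. -/
noncomputable instance : SemilatticeSup T.Point where
  sup x y := (exists_isLUB_pair x y).choose
  le_sup_left x y := (exists_isLUB_pair x y).choose_spec.1 (by simp)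
  le_sup_right x y := (exists_isLUB_pair x y).choose_spec.1 (by simp)
  sup_le x y z hx hy := (exists_isLUB_pair x y).choose_spec.2 (by
    rintro w (rfl | rfl)
    · exact hx
    · exact hy)

theorem height_mono {x y : T.Point} (h : x ≤ y) : x.height ≤ y.height := h.2

theorem eq_of_le_of_height_eq {x y : T.Point} (h : x ≤ y) (hh : x.height = y.height) : x = y := by
  obtain ⟨h1, h2⟩ := h
  refine Point.ext ?_ hh
  unfold Anc at h1
  rcases Relation.ReflTransGen.cases_head h1 with h3 | ⟨d, hd, hda⟩
  · exact h3
  · have := (x.height_lt d hd.1 hd.2).trans_le ((Anc.le hda).trans y.le_height)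
    rw [hh] at this
    exact absurd this (lt_irrefl _)

theorem le_total_of_le {x y z : T.Point} (hy : x ≤ y) (hz : x ≤ z) : y ≤ z ∨ z ≤ y := by
  have main : ∀ y z : T.Point, T.Anc y.v z.v → y ≤ z ∨ z ≤ y := by
    intro y z h
    rcases Relation.ReflTransGen.cases_head h with h1 | ⟨d, hd, hda⟩
    · rcases le_total y.height z.height with h2 | h2
      · exact Or.inl ⟨h, h2⟩
      · refine Or.inr ⟨?_, h2⟩
        rw [h1]
        exact Relation.ReflTransGen.refl
    · exact Or.inl ⟨h, WithTop.coe_le_coe.1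
        ((y.height_lt d hd.1 hd.2).trans_le ((Anc.le hda).trans z.le_height)).le⟩
  rcases Anc.total hy.1 hz.1 with h | h
  · exact main y z h
  · exact (main z y h).symm

/-- The metric on `|T|`: the length of the path from `x` to `y`, which goes up from `x` to the
lowest common ancestor and from there down to `y`. -/
noncomputable instance : MetricSpace T.Point where
  dist x y := ((x ⊔ y).height - x.height) + ((x ⊔ y).height - y.height)
  dist_self x := by simp
  dist_comm x y := by rw [sup_comm]; ring
  dist_triangle x y z := by
    have h1 := height_mono (le_sup_right : y ≤ x ⊔ y)
    have h2 := height_mono (le_sup_left : y ≤ y ⊔ z)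
    rcases le_total_of_le (le_sup_right : y ≤ x ⊔ y) (le_sup_left : y ≤ y ⊔ z) with h | h
    · have := height_mono (sup_le (le_sup_left.trans h) le_sup_right : x ⊔ z ≤ y ⊔ z)
      linarith
    · have := height_mono (sup_le le_sup_left (le_sup_right.trans h) : x ⊔ z ≤ x ⊔ y)
      linarith
  eq_of_dist_eq_zero {x y} h := by
    have h1 := height_mono (le_sup_left : x ≤ x ⊔ y)
    have h2 := height_mono (le_sup_right : y ≤ x ⊔ y)
    rw [eq_of_le_of_height_eq (le_sup_left : x ≤ x ⊔ y) (by linarith)]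
    exact (eq_of_le_of_height_eq (le_sup_right : y ≤ x ⊔ y) (by linarith)).symm

/-- The depth of a point: the largest height difference between it and a point of the subtree
below it. -/
noncomputable def depth (w : T.Point) : ℝ :=
  sSup ((fun u : T.Point => w.height - u.height) '' Set.Iic w)

end Point

/-- A `δ`-good map `|T| → |T'|`. The least upper bound in the second clause is the lowest common
ancestor of the fibre over `w`. -/
structure IsGood {T : MergeTree.{u}} {T' : MergeTree.{u'}} (δ : ℝ) (α : T.Point → T'.Point) :
    Prop where
  continuous : Continuous α
  shift : ∀ x, (α x).height - x.height = δ
  fibre : ∀ w ∈ Set.range α, ∃ x', IsLUB (α ⁻¹' {w}) x' ∧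
    ∀ u ∈ α ⁻¹' {w}, x'.height - u.height ≤ 2 * δ
  depth_le : ∀ w, w ∉ Set.range α → w.depth ≤ 2 * δ

/-- The interleaving distance. -/
noncomputable def interleavingDist (T : MergeTree.{u}) (T' : MergeTree.{u'}) : ℝ :=
  sInf {δ : ℝ | ∃ α : T.Point → T'.Point, IsGood δ α}

/-- A labelling of `T` by `{1, …, n}`: a map from the labels to the vertices (of finite height)
whose image contains all leaves. -/
structure Labeling (T : MergeTree.{u}) (n : ℕ) where
  /-- the labelled vertices -/
  toFun : Fin n → T.V
  ne_root : ∀ i, toFun i ≠ T.root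
  surj_leaf : ∀ v, T.IsLeaf v → ∃ i, toFun i = v

/-- A non-root vertex as a point of `|T|`. -/
noncomputable def vertexPoint (T : MergeTree.{u}) (v : T.V) (hv : v ≠ T.root) : T.Point where
  v := v
  height := (T.f v).untop (fun h => hv ((T.eq_top_iff v).1 h))
  ne_root := hv
  le_height := by rw [WithTop.coe_untop]
  height_lt p _ h := by rwa [WithTop.coe_untop]

/-- The induced matrix of a labelled merge tree: the `(i, j)` entry is the height of the lowest
common ancestor of the vertices with labels `i` and `j`. -/
noncomputable def inducedMatrix (T : MergeTree.{u}) {n : ℕ} (π : T.Labeling n) :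
    Matrix (Fin n) (Fin n) ℝ :=
  Matrix.of fun i j =>
    (T.vertexPoint (π.toFun i) (π.ne_root i) ⊔ T.vertexPoint (π.toFun j) (π.ne_root j)).height

/-- The labelled interleaving distance: the largest absolute value of an entry of the difference of
the induced matrices (the norm is the sup norm on functions of the pair of indices). -/
noncomputable def labeledInterleavingDist (T : MergeTree.{u}) (T' : MergeTree.{u'}) {n : ℕ}
    (π : T.Labeling n) (π' : T'.Labeling n) : ℝ :=
  ‖fun p : Fin n × Fin n => T.inducedMatrix π p.1 p.2 - T'.inducedMatrix π' p.1 p.2‖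

/-- `S` is obtained from `T` by subdividing edges: the vertices of `T` are vertices of `S`, with the
same heights and the same ancestor relation, and every additional vertex has degree two. -/
def IsSubdivision (S T : MergeTree.{u}) : Prop :=
  ∃ ι : T.V → S.V, Function.Injective ι ∧ (∀ v, S.f (ι v) = T.f v) ∧
    (∀ v w, S.Anc (ι v) (ι w) ↔ T.Anc v w) ∧
    ∀ s, s ∉ Set.range ι → (S.G.neighborSet s).ncard = 2

end MergeTree

/-!
A `δ`-good map is monotone, since continuity forces a path along which the height increases strictly
to go up. Conversely, a monotone map that shifts heights by `δ` is `1`-Lipschitz, so being `δ`-good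
amounts to monotonicity, the shift and the two bounds by `2δ`, all of which are closed conditions.

*Attainment.* There are finitely many vertices and edges, so `δ`-good maps for values of `δ`
arbitrarily close to the infimum `d` send each vertex to the same edge. Lowering the image of each
vertex on that edge to the height prescribed by `d` is possible, as edges contain their lower ends,
and extending upwards from the vertices gives a map that lies below all of these good maps and
inherits their properties in the limit.

*Labels.* Given a `δ`-good map `α`, label each vertex `x` of `T` together with `α x`, and each
vertex `y` of `T'` together with a point that `α` sends to the lowest ancestor of `y` in the image.
Heights of lowest common ancestors of labelled pairs then differ by at most `δ`, and the pair
`(x, α x)` alone shows that `δ` is attained. The trees are subdivided at the labelled points.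
-/

open Filter Topology

section Order

open SimpleGraph

variable {β : Type*} [PartialOrder β]

theorem eq_of_covBy_of_isChain_Ici {a b c : β} (hchain : IsChain (· ≤ ·) (Set.Ici a))
    (hb : a ⋖ b) (hc : a ⋖ c) : b = c := by
  rcases hchain.total hb.le hc.le with h | h
  · exact (hc.eq_or_eq hb.le h).resolve_left hb.ne'
  · exact ((hb.eq_or_eq hc.le h).resolve_left hc.ne').symm

theorem existsUnique_covBy_of_isChain_Ici [IsStronglyAtomic β] {a : β}
    (hchain : IsChain (· ≤ ·) (Set.Ici a)) (ha : ¬IsMax a) : ∃! b, a ⋖ b := by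
  obtain ⟨c, hac⟩ := not_isMax_iff.1 ha
  obtain ⟨b, hb, -⟩ := exists_covBy_le_of_lt hac
  exact ⟨b, hb, fun c hc => eq_of_covBy_of_isChain_Ici hchain hc hb⟩

theorem existsUnique_covBy_of_forall_lt_le_or_le [IsStronglyCoatomic β] {x y : β}
    (hchain : IsChain (· ≤ ·) (Set.Ici y)) (hyx : y < x) (hy : ∀ c < x, c ≤ y ∨ y ≤ c) :
    ∃! b, b ⋖ x := by
  obtain ⟨b, hyb, hb⟩ := exists_le_covBy_of_lt hyx
  have y_le {c : β} (hc : c ⋖ x) : y ≤ c :=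
    (hy c hc.lt).elim (fun h => ((hc.eq_or_eq h hyx.le).resolve_right hyx.ne).le) id
  refine ⟨b, hb, fun c hc => ?_⟩
  rcases hchain.total hyb (y_le hc) with h | h
  · exact (hb.eq_or_eq h hc.le).resolve_right hc.ne
  · exact ((hc.eq_or_eq h hb.le).resolve_right hb.ne).symm

theorem isAcyclic_hasse_of_isChain_Ici (hchain : ∀ a : β, IsChain (· ≤ ·) (Set.Ici a)) :
    (hasse β).IsAcyclic := by
  rw [isAcyclic_iff_forall_adj_isBridge]
  -- Deleting the edge from `a` up to `b` leaves no edge out of the set of elements below `a`.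
  have isBridge_of_covBy {a b : β} (hab : a ⋖ b) : (hasse β).IsBridge s(a, b) := by
    rw [isBridge_iff]
    intro hreach
    have le_a {c : β} (hc : ((hasse β).deleteEdges {s(a, b)}).Reachable a c) : c ≤ a := by
      rw [reachable_iff_reflTransGen] at hc
      induction hc with
      | refl => exact le_rfl
      | @tail c d _ hcd hca =>
        obtain ⟨hcd, hne⟩ := deleteEdges_adj.1 hcd
        rcases hasse_adj.1 hcd with h | h
        · rcases hca.eq_or_lt with rfl | hca
          · have hdb : d = b := eq_of_covBy_of_isChain_Ici (hchain c) h hab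
            exact absurd (hdb ▸ Set.mem_singleton _) hne
          · exact ((hchain c).total h.le hca.le).elim id fun had =>
              ((h.eq_or_eq hca.le had).resolve_left hca.ne').ge
        · exact h.le.trans hca
    exact hab.lt.not_ge (le_a hreach)
  intro a b hab
  rcases hasse_adj.1 hab with h | h
  · exact isBridge_of_covBy h
  · exact Sym2.eq_swap ▸ isBridge_of_covBy h

theorem connected_hasse [OrderTop β] [WellFoundedGT β] [IsStronglyAtomic β] :
    (hasse β).Connected := by
  have reachable_top (a : β) : (hasse β).Reachable a ⊤ := by
    induction a using (wellFounded_gt (α := β)).induction with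
    | _ a ih =>
      rcases eq_or_ne a ⊤ with rfl | ha
      · rfl
      · obtain ⟨b, hb, -⟩ := exists_covBy_le_of_lt ha.lt_top
        exact (Adj.reachable (hasse_adj.2 (Or.inl hb))).trans (ih b hb.lt)
  exact ⟨fun a b => (reachable_top a).trans (reachable_top b).symm⟩

theorem ncard_neighborSet_hasse_eq_two {a : β} (hup : ∃! b, a ⋖ b) (hdown : ∃! b, b ⋖ a) :
    ((hasse β).neighborSet a).ncard = 2 := by
  obtain ⟨b, hb, eq_b⟩ := hup
  obtain ⟨c, hc, eq_c⟩ := hdown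
  refine Set.ncard_eq_two.2 ⟨b, c, (hc.lt.trans hb.lt).ne', Set.ext fun d => ?_⟩
  rw [mem_neighborSet, hasse_adj]
  exact ⟨Or.imp (eq_b d) (eq_c d), by rintro (rfl | rfl); exacts [Or.inl hb, Or.inr hc]⟩

theorem exists_isGreatest_of_supClosed {α : Type*} [SemilatticeSup α] {s : Set α}
    (hs : SupClosed s) (hfin : s.Finite) (hne : s.Nonempty) : ∃ m, IsGreatest s m := by
  obtain ⟨m, hm⟩ := hfin.exists_maximal hne
  exact ⟨m, hm.prop, fun x hx =>
    le_sup_right.trans (hm.le_of_ge (hs hm.prop hx) le_sup_left)⟩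

theorem exists_isLUB_sup_of_isChain_Ici {α : Type*} [SemilatticeSup α] {s : Set α}
    {a : α} (hchain : IsChain (· ≤ ·) (Set.Ici a)) (hs : s.Finite) (ha : a ∈ s) :
    ∃ b ∈ s, IsLUB s (a ⊔ b) := by
  obtain ⟨b, hb, hmax⟩ := hs.exists_maximalFor (a ⊔ ·) s ⟨a, ha⟩
  refine ⟨b, hb, fun c hc => (le_sup_right : c ≤ a ⊔ c).trans ?_,
    fun c hc => sup_le (hc ha) (hc hb)⟩
  exact (hchain.total (le_sup_left : a ≤ a ⊔ c) (le_sup_left : a ≤ a ⊔ b)).elim id (hmax hc)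

theorem isChain_Ici_withTop (hchain : ∀ a : β, IsChain (· ≤ ·) (Set.Ici a)) (a : WithTop β) :
    IsChain (· ≤ ·) (Set.Ici a) := by
  intro b hb c hc _
  induction b with
  | top => exact Or.inr le_top
  | coe b =>
    induction c with
    | top => exact Or.inl le_top
    | coe c =>
      induction a with
      | top => exact absurd hb (WithTop.not_top_le_coe b)
      | coe a =>
        simp only [WithTop.coe_le_coe, Set.mem_Ici] at hb hc ⊢
        exact (hchain a).total hb hc

theorem hasse_adj_and_lt_iff_covBy {γ : Type*} [Preorder γ] {f : β → γ} (hf : StrictMono f)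
    {a b : β} : (hasse β).Adj a b ∧ f a < f b ↔ a ⋖ b := by
  rw [hasse_adj]
  exact ⟨fun ⟨h, hlt⟩ => h.resolve_right fun hba => hlt.asymm (hf hba.lt),
    fun h => ⟨Or.inl h, hf h.lt⟩⟩

theorem neighborSet_hasse_withTop_top {m : β} (hm : IsTop m) :
    (hasse (WithTop β)).neighborSet ⊤ = {(m : WithTop β)} := by
  ext a
  rw [mem_neighborSet, hasse_adj, or_iff_right fun h : ⊤ ⋖ a => not_top_lt h.lt,
    Set.mem_singleton_iff]
  induction a with
  | top => exact iff_of_false (fun h => h.lt.false) WithTop.top_ne_coe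
  | coe a =>
    rw [WithTop.coe_covBy_top, WithTop.coe_inj]
    exact ⟨fun ha => ha.eq_of_le (hm a), fun ha => ha ▸ hm.isMax⟩

end Order

namespace MergeTree

namespace Point

variable {T : MergeTree.{u}} {x y z : T.Point}

theorem isChain_Ici (x : T.Point) : IsChain (· ≤ ·) (Set.Ici x) :=
  fun _ hy _ hz _ => le_total_of_le hy hz

theorem le_of_le_of_height_le (hy : x ≤ y) (hz : x ≤ z) (h : y.height ≤ z.height) : y ≤ z :=
  (le_total_of_le hy hz).elim id fun hzy =>
    (eq_of_le_of_height_eq hzy (le_antisymm (height_mono hzy) h)).ge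

theorem eq_of_le_of_le_of_height_eq (hy : x ≤ y) (hz : x ≤ z) (h : y.height = z.height) : y = z :=
  eq_of_le_of_height_eq (le_of_le_of_height_le hy hz h.le) h

theorem le_of_v_eq (h : x.v = y.v) (hh : x.height ≤ y.height) : x ≤ y :=
  ⟨h ▸ Relation.ReflTransGen.refl, hh⟩

theorem height_strictMono : StrictMono (height : T.Point → ℝ) := fun _ _ h =>
  (height_mono h.le).lt_of_ne fun hh => h.ne (eq_of_le_of_height_eq h.le hh)

theorem coe_height_vertexPoint (v : T.V) (hv : v ≠ T.root) :
    ((T.vertexPoint v hv).height : WithTop ℝ) = T.f v :=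
  WithTop.coe_untop _ _

theorem vertexPoint_v_le (x : T.Point) : T.vertexPoint x.v x.ne_root ≤ x :=
  le_of_v_eq rfl (WithTop.coe_le_coe.1 ((coe_height_vertexPoint _ _).trans_le x.le_height))

theorem vertexPoint_le_vertexPoint {v w : T.V} {hv : v ≠ T.root} {hw : w ≠ T.root} :
    T.vertexPoint v hv ≤ T.vertexPoint w hw ↔ T.Anc v w :=
  ⟨fun h => h.1, fun h => ⟨h, WithTop.coe_le_coe.1 (by
    simpa only [coe_height_vertexPoint] using h.le)⟩⟩

theorem le_vertexPoint {v : T.V} (hv : v ≠ T.root) (h : T.Anc x.v v) (hne : x.v ≠ v) :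
    x ≤ T.vertexPoint v hv := by
  rcases Relation.ReflTransGen.cases_head h with h | ⟨p, hp, hpv⟩
  · exact absurd h hne
  · refine ⟨h, WithTop.coe_le_coe.1 ?_⟩
    rw [coe_height_vertexPoint]
    exact (x.height_lt p hp.1 hp.2).le.trans (Anc.le hpv)

theorem le_vertexPoint_v_or_vertexPoint_v_le (h : x ≤ y) :
    x ≤ T.vertexPoint y.v y.ne_root ∨ T.vertexPoint y.v y.ne_root ≤ x := by
  by_cases hv : x.v = y.v
  · right
    simpa only [← hv] using x.vertexPoint_v_le
  · exact Or.inl (le_vertexPoint y.ne_root h.1 hv)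

theorem vertexPoint_sup_vertexPoint {a b c : T.V} (ha : a ≠ T.root) (hb : b ≠ T.root)
    (hc : c ≠ T.root) (hac : T.Anc a c) (hbc : T.Anc b c)
    (hleast : ∀ d, d ≠ T.root → T.Anc a d → T.Anc b d → T.Anc c d) :
    T.vertexPoint a ha ⊔ T.vertexPoint b hb = T.vertexPoint c hc := by
  refine le_antisymm
    (sup_le (vertexPoint_le_vertexPoint.2 hac) (vertexPoint_le_vertexPoint.2 hbc)) ?_
  set z := T.vertexPoint a ha ⊔ T.vertexPoint b hb
  have haz : T.vertexPoint a ha ≤ z := le_sup_left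
  have hbz : T.vertexPoint b hb ≤ z := le_sup_right
  exact (vertexPoint_le_vertexPoint.2 (hleast z.v z.ne_root haz.1 hbz.1)).trans z.vertexPoint_v_le

end Point

/-- The vertices of finite height, as points of `|T|`. -/
def vertexPoints (T : MergeTree.{u}) : Set T.Point :=
  Set.range fun v : {v : T.V // v ≠ T.root} => T.vertexPoint v.1 v.2

variable {T : MergeTree.{u}}

theorem vertexPoint_mem_vertexPoints (v : T.V) (hv : v ≠ T.root) :
    T.vertexPoint v hv ∈ T.vertexPoints :=
  ⟨⟨v, hv⟩, rfl⟩

theorem finite_vertexPoints (T : MergeTree.{u}) : T.vertexPoints.Finite :=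
  have := T.finite
  Set.finite_range _

theorem nonempty_vertexPoints (T : MergeTree.{u}) : T.vertexPoints.Nonempty := by
  obtain ⟨c, hc⟩ := Set.ncard_eq_one.1 T.root_degree
  have hadj : T.G.Adj T.root c := (T.G.mem_neighborSet _ _).1 (hc ▸ Set.mem_singleton c)
  exact ⟨_, vertexPoint_mem_vertexPoints c hadj.ne'⟩

instance (T : MergeTree.{u}) : Nonempty T.Point :=
  T.nonempty_vertexPoints.nonempty

namespace Point

variable {x y : T.Point}

theorem sup_eq_left_or_sup_eq_right_or_sup_mem_vertexPoints (x y : T.Point) :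
    x ⊔ y = x ∨ x ⊔ y = y ∨ x ⊔ y ∈ T.vertexPoints := by
  set z := x ⊔ y
  have hx : x ≤ z := le_sup_left
  have hy : y ≤ z := le_sup_right
  rcases le_vertexPoint_v_or_vertexPoint_v_le hx with hxv | hvx
  · rcases le_vertexPoint_v_or_vertexPoint_v_le hy with hyv | hvy
    · exact Or.inr (Or.inr ⟨⟨z.v, z.ne_root⟩, le_antisymm z.vertexPoint_v_le (sup_le hxv hyv)⟩)
    · exact Or.inr (Or.inl (sup_eq_right.2 (hxv.trans hvy)))
  · rcases le_vertexPoint_v_or_vertexPoint_v_le hy with hyv | hvy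
    · exact Or.inl (sup_eq_left.2 (hyv.trans hvx))
    · rcases le_total_of_le hvx hvy with h | h
      · exact Or.inr (Or.inl (sup_eq_right.2 h))
      · exact Or.inl (sup_eq_left.2 h)

theorem supClosed_of_vertexPoints_subset {s : Set T.Point} (hs : T.vertexPoints ⊆ s) :
    SupClosed s := by
  intro x hx y hy
  rcases sup_eq_left_or_sup_eq_right_or_sup_mem_vertexPoints x y with h | h | h
  · rwa [h]
  · rwa [h]
  · exact hs h

theorem exists_forall_le_height (T : MergeTree.{u}) : ∃ m, ∀ x : T.Point, m ≤ x.height := by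
  obtain ⟨p, -, hp⟩ := Set.exists_min_image _ height T.finite_vertexPoints T.nonempty_vertexPoints
  exact ⟨p.height, fun x =>
    (hp _ (vertexPoint_mem_vertexPoints x.v x.ne_root)).trans (height_mono x.vertexPoint_v_le)⟩

theorem exists_forall_le_of_height_le (T : MergeTree.{u}) :
    ∃ q : T.Point, ∀ x : T.Point, q.height ≤ x.height → q ≤ x := by
  obtain ⟨q, -, hq⟩ := Set.exists_max_image _ height T.finite_vertexPoints T.nonempty_vertexPoints
  refine ⟨q, fun x hx => ?_⟩
  have sup_height_le : (q ⊔ x).height ≤ x.height := by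
    rcases sup_eq_left_or_sup_eq_right_or_sup_mem_vertexPoints q x with h | h | h
    · rwa [h]
    · rw [h]
    · exact (hq _ h).trans hx
  exact le_sup_left.trans (eq_of_le_of_height_eq le_sup_right
    (le_antisymm (height_mono le_sup_right) sup_height_le)).ge

theorem exists_ge_height_eq (x : T.Point) {t : ℝ} (ht : x.height ≤ t) :
    ∃ y, x ≤ y ∧ y.height = t := by
  have := T.finite
  obtain ⟨a, ⟨ha, hat⟩, hmax⟩ := Set.exists_max_image {a | T.Anc x.v a ∧ T.f a ≤ (t : WithTop ℝ)}
    T.f (Set.toFinite _)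
    ⟨x.v, Relation.ReflTransGen.refl, x.le_height.trans (WithTop.coe_le_coe.2 ht)⟩
  have a_ne_root : a ≠ T.root := fun h =>
    (hat.trans_lt (WithTop.coe_lt_top t)).ne ((T.eq_top_iff a).2 h)
  refine ⟨⟨a, t, a_ne_root, hat, fun p hp hlt => ?_⟩, ⟨ha, ht⟩, rfl⟩
  by_contra! hpt
  exact (hmax p ⟨ha.tail ⟨hp, hlt⟩, hpt⟩).not_gt hlt

/-- The ancestor of `x` at height `t`, or `x` itself if `t` is below the height of `x`. -/
noncomputable def ancestorAt (x : T.Point) (t : ℝ) : T.Point :=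
  (exists_ge_height_eq x (le_max_left x.height t)).choose

theorem le_ancestorAt (x : T.Point) (t : ℝ) : x ≤ x.ancestorAt t :=
  (exists_ge_height_eq x (le_max_left x.height t)).choose_spec.1

theorem height_ancestorAt (x : T.Point) (t : ℝ) : (x.ancestorAt t).height = max x.height t :=
  (exists_ge_height_eq x (le_max_left x.height t)).choose_spec.2

theorem height_ancestorAt_of_le {t : ℝ} (ht : x.height ≤ t) : (x.ancestorAt t).height = t := by
  rw [height_ancestorAt, max_eq_right ht]

theorem ancestorAt_mono (x : T.Point) : Monotone x.ancestorAt := fun s t h =>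
  le_of_le_of_height_le (x.le_ancestorAt s) (x.le_ancestorAt t) (by
    simpa only [height_ancestorAt] using max_le_max_left _ h)

theorem ancestorAt_height (h : x ≤ y) : x.ancestorAt y.height = y :=
  eq_of_le_of_le_of_height_eq (x.le_ancestorAt _) h (height_ancestorAt_of_le (height_mono h))

theorem dist_eq (x y : T.Point) :
    dist x y = ((x ⊔ y).height - x.height) + ((x ⊔ y).height - y.height) := rfl

theorem dist_of_le (h : x ≤ y) : dist x y = y.height - x.height := by
  rw [dist_eq, sup_eq_right.2 h, sub_self, add_zero]

theorem lipschitzWith_height : LipschitzWith 1 (height : T.Point → ℝ) :=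
  LipschitzWith.mk_one fun x y => by
    have hx := height_mono (le_sup_left : x ≤ x ⊔ y)
    have hy := height_mono (le_sup_right : y ≤ x ⊔ y)
    rw [dist_eq, Real.dist_eq, abs_le]
    constructor <;> linarith

theorem lipschitzWith_ancestorAt (x : T.Point) : LipschitzWith 1 x.ancestorAt := by
  have dist_ancestorAt {s t : ℝ} (h : s ≤ t) : dist (x.ancestorAt s) (x.ancestorAt t) ≤ t - s := by
    rw [dist_of_le (x.ancestorAt_mono h), height_ancestorAt, height_ancestorAt, sub_le_iff_le_add]
    exact max_le (by linarith [le_max_left x.height s]) (by linarith [le_max_right x.height s])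
  refine LipschitzWith.mk_one fun s t => ?_
  rw [Real.dist_eq]
  rcases le_total s t with h | h
  · exact (dist_ancestorAt h).trans (abs_sub_comm s t ▸ le_abs_self _)
  · exact dist_comm (x.ancestorAt t) _ ▸ (dist_ancestorAt h).trans (le_abs_self _)

theorem le_iff_dist_eq : x ≤ y ↔ dist x y = y.height - x.height := by
  refine ⟨dist_of_le, fun h => ?_⟩
  rw [dist_eq] at h
  exact sup_eq_right.1 (eq_of_le_of_height_eq le_sup_right (by linarith)).symm

theorem isClosed_Ici (x : T.Point) : IsClosed (Set.Ici x) := by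
  simp only [Set.Ici, le_iff_dist_eq]
  exact isClosed_eq (continuous_const.dist continuous_id)
    (lipschitzWith_height.continuous.sub continuous_const)

theorem continuous_height_sup (x : T.Point) : Continuous fun y => (x ⊔ y).height := by
  have : (fun y => (x ⊔ y).height) = fun y => (dist x y + x.height + y.height) / 2 := by
    funext y
    rw [dist_eq]
    ring
  rw [this]
  exact ((continuous_const.dist continuous_id).add continuous_const).add
    lipschitzWith_height.continuous |>.div_const 2

theorem eventually_le_of_height_le (x : T.Point) : ∀ᶠ y in 𝓝 x, x.height ≤ y.height → x ≤ y := by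
  obtain ⟨p, hp, -⟩ := T.exists_unique_higher x.v x.ne_root
  obtain ⟨c, hxc, hcp⟩ := exists_between (x.height_lt p hp.1 hp.2)
  lift c to ℝ using hcp.ne_top
  have near : ∀ᶠ y in 𝓝 x, (x ⊔ y).height < c :=
    (continuous_height_sup x).tendsto x |>.eventually_lt_const (by simpa using hxc)
  filter_upwards [near] with y hy hxy
  have v_eq : x.v = (x ⊔ y).v := by
    rcases Relation.ReflTransGen.cases_head (le_sup_left : x ≤ x ⊔ y).1 with h | ⟨d, hd, hdz⟩
    · exact h
    · have : T.f p ≤ c := T.higher_unique hd hp ▸ ((Anc.le hdz).trans (x ⊔ y).le_height).trans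
        (WithTop.coe_le_coe.2 hy.le)
      exact absurd hcp this.not_gt
  have hvx : T.vertexPoint (x ⊔ y).v (x ⊔ y).ne_root ≤ x := by
    simpa only [← v_eq] using x.vertexPoint_v_le
  rcases le_vertexPoint_v_or_vertexPoint_v_le (le_sup_right : y ≤ x ⊔ y) with h | h
  · exact (eq_of_le_of_height_eq (h.trans hvx) (le_antisymm (height_mono (h.trans hvx)) hxy)).ge
  · exact le_of_le_of_height_le hvx h hxy

theorem finite_setOf_height_eq (t : ℝ) : {x : T.Point | x.height = t}.Finite :=
  have := T.finite
  Set.Finite.of_injOn (f := Point.v) (t := Set.univ) (fun _ _ => Set.mem_univ _)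
    (fun _ hx _ hy h => Point.ext h (hx.trans hy.symm)) Set.finite_univ

theorem depth_le_iff {w : T.Point} {d : ℝ} :
    w.depth ≤ d ↔ ∀ u ≤ w, w.height - u.height ≤ d := by
  obtain ⟨m, hm⟩ := exists_forall_le_height T
  have bdd : BddAbove ((fun u : T.Point => w.height - u.height) '' Set.Iic w) :=
    ⟨w.height - m, Set.forall_mem_image.2 fun u _ => sub_le_sub_left (hm u) _⟩
  rw [depth, csSup_le_iff bdd ⟨_, w, Set.self_mem_Iic, rfl⟩, Set.forall_mem_image]
  rfl

/-- The edge above a vertex is the half-open interval that contains its lower end, so it is closed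
under limits from above. -/
theorem exists_v_eq_and_height_eq {v : T.V} {t : ℝ}
    (h : ∃ᶠ s in 𝓝 t, t ≤ s ∧ ∃ x : T.Point, x.v = v ∧ x.height = s) :
    ∃ x : T.Point, x.v = v ∧ x.height = t := by
  obtain ⟨_, hts, x, rfl, rfl⟩ := h.exists
  have le_t : (T.vertexPoint x.v x.ne_root).height ≤ t := by
    refine ge_of_tendsto_of_frequently tendsto_id (h.mono ?_)
    rintro _ ⟨-, y, hy, rfl⟩
    simpa only [id, hy] using height_mono y.vertexPoint_v_le
  refine ⟨⟨x.v, t, x.ne_root, ?_, fun p hp hlt => ?_⟩, rfl, rfl⟩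
  · rw [← coe_height_vertexPoint x.v x.ne_root]
    exact WithTop.coe_le_coe.2 le_t
  · exact (WithTop.coe_le_coe.2 hts).trans_lt (x.height_lt p hp hlt)

theorem le_of_continuousOn_of_strictMonoOn_height {γ : ℝ → T.Point} {a b : ℝ} (hab : a ≤ b)
    (hγ : ContinuousOn γ (Set.Icc a b))
    (hheight : StrictMonoOn (fun t => (γ t).height) (Set.Icc a b)) : γ a ≤ γ b := by
  have closed : IsClosed ({t | γ a ≤ γ t} ∩ Set.Icc a b) :=
    Set.inter_comm (Set.Icc a b) _ ▸
      hγ.preimage_isClosed_of_isClosed isClosed_Icc (isClosed_Ici (γ a))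
  refine closed.mem_of_ge_of_forall_exists_gt (le_refl (γ a)) hab ?_
  rintro t ⟨hat, hta, htb⟩
  have near : ∀ᶠ s in 𝓝[>] t, (γ t).height ≤ (γ s).height → γ t ≤ γ s :=
    ((hγ t ⟨hta, htb.le⟩).mono_of_mem_nhdsWithin (Icc_mem_nhdsGT_of_mem ⟨hta, htb⟩)).eventually
      (eventually_le_of_height_le (γ t))
  obtain ⟨s, hs, hts, hsb⟩ := (near.and (Ioc_mem_nhdsGT htb)).exists
  exact ⟨s, hat.trans (hs (hheight ⟨hta, htb.le⟩ ⟨hta.trans hts.le, hsb⟩ hts).le), hts, hsb⟩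

end Point

section IsGood

variable {T' : MergeTree.{u'}} {δ : ℝ} {α : T.Point → T'.Point}

theorem Point.apply_ancestorAt_of_monotone (hmono : Monotone α)
    (hshift : ∀ x, (α x).height = x.height + δ) {x : T.Point} {w : T'.Point} (hw : α x ≤ w) :
    α (x.ancestorAt (w.height - δ)) = w := by
  have height_le := hshift x ▸ height_mono hw
  refine eq_of_le_of_le_of_height_eq (hmono (x.le_ancestorAt _)) hw ?_
  rw [hshift, height_ancestorAt_of_le (le_sub_iff_add_le.2 height_le), sub_add_cancel]

namespace IsGood

theorem height_eq (h : IsGood δ α) (x : T.Point) : (α x).height = x.height + δ := by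
  linarith [h.shift x]

theorem monotone (h : IsGood δ α) : Monotone α := by
  intro x y hxy
  have height_eq_of_mem {t : ℝ} (ht : t ∈ Set.Icc x.height y.height) :
      (α (x.ancestorAt t)).height = t + δ := by
    rw [h.height_eq, Point.height_ancestorAt_of_le ht.1]
  have endpoints_le := Point.le_of_continuousOn_of_strictMonoOn_height (Point.height_mono hxy)
    (h.continuous.comp x.lipschitzWith_ancestorAt.continuous).continuousOn
    fun s hs t ht hst => by
      simpa only [Function.comp_apply, height_eq_of_mem hs, height_eq_of_mem ht] using
        add_lt_add_left hst δ
  simpa only [Function.comp_apply, Point.ancestorAt_height le_rfl, Point.ancestorAt_height hxy]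
    using endpoints_le

theorem height_sup_sub_height_le (h : IsGood δ α) {u v : T.Point} (huv : α u = α v) :
    (u ⊔ v).height - u.height ≤ 2 * δ := by
  obtain ⟨x, hx, hle⟩ := h.fibre (α u) ⟨u, rfl⟩
  have := Point.height_mono (sup_le (hx.1 rfl) (hx.1 huv.symm) : u ⊔ v ≤ x)
  linarith [hle u rfl]

theorem height_sub_height_le (h : IsGood δ α) {u w : T'.Point} (hw : w ∉ Set.range α)
    (hu : u ≤ w) : w.height - u.height ≤ 2 * δ :=
  Point.depth_le_iff.1 (h.depth_le w hw) u hu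

theorem nonneg (h : IsGood δ α) : 0 ≤ δ := by
  have x := Classical.arbitrary T.Point
  have := h.height_sup_sub_height_le (rfl : α x = α x)
  rw [sup_idem, sub_self] at this
  linarith

theorem apply_ancestorAt (h : IsGood δ α) {x : T.Point} {w : T'.Point} (hw : α x ≤ w) :
    α (x.ancestorAt (w.height - δ)) = w :=
  Point.apply_ancestorAt_of_monotone h.monotone h.height_eq hw

theorem of_monotone (hmono : Monotone α) (hshift : ∀ x, (α x).height = x.height + δ)
    (hfibre : ∀ u v, α u = α v → (u ⊔ v).height - u.height ≤ 2 * δ)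
    (hdepth : ∀ w ∉ Set.range α, ∀ u ≤ w, w.height - u.height ≤ 2 * δ) : IsGood δ α where
  continuous := by
    refine (LipschitzWith.mk_one fun x y => ?_).continuous
    have := Point.height_mono (sup_le (hmono le_sup_left) (hmono le_sup_right) :
      α x ⊔ α y ≤ α (x ⊔ y))
    rw [Point.dist_eq, Point.dist_eq, hshift x, hshift y]
    linarith [hshift (x ⊔ y)]
  shift x := by rw [hshift, add_sub_cancel_left]
  fibre := by
    rintro _ ⟨u, rfl⟩
    have height_eq {v : T.Point} (hv : α v = α u) : v.height = u.height := by
      linarith [hshift u, hshift v, congrArg Point.height hv]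
    obtain ⟨v, hv, hlub⟩ := exists_isLUB_sup_of_isChain_Ici u.isChain_Ici
      ((Point.finite_setOf_height_eq u.height).subset fun _ => height_eq)
      (show u ∈ α ⁻¹' {α u} from rfl)
    exact ⟨u ⊔ v, hlub, fun w hw => height_eq hw ▸ hfibre u v (Eq.symm hv)⟩
  depth_le w hw := Point.depth_le_iff.2 (hdepth w hw)

end IsGood

theorem Point.height_sup_le_max {q u v : T.Point}
    (hq : ∀ x : T.Point, q.height ≤ x.height → q ≤ x) (h : u.height = v.height) :
    (u ⊔ v).height ≤ max q.height u.height := by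
  obtain ⟨t, ht⟩ : ∃ t, t = max q.height u.height := ⟨_, rfl⟩
  have height_u : (u.ancestorAt t).height = t := height_ancestorAt_of_le (ht ▸ le_max_right _ _)
  have height_v : (v.ancestorAt t).height = t :=
    height_ancestorAt_of_le (h ▸ ht ▸ le_max_right _ _)
  have ancestor_eq : u.ancestorAt t = v.ancestorAt t :=
    eq_of_le_of_le_of_height_eq (hq _ (by rw [height_u, ht]; exact le_max_left _ _))
      (hq _ (by rw [height_v, ht]; exact le_max_left _ _)) (height_u.trans height_v.symm)
  rw [← ht, ← height_u]
  exact height_mono (sup_le (u.le_ancestorAt t) (ancestor_eq ▸ v.le_ancestorAt t))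

theorem exists_isGood (T : MergeTree.{u}) (T' : MergeTree.{u'}) :
    ∃ (δ : ℝ) (α : T.Point → T'.Point), IsGood δ α := by
  obtain ⟨q, hq⟩ := Point.exists_forall_le_of_height_le T
  obtain ⟨q', hq'⟩ := Point.exists_forall_le_of_height_le T'
  obtain ⟨m, hm⟩ := Point.exists_forall_le_height T
  obtain ⟨m', hm'⟩ := Point.exists_forall_le_height T'
  obtain ⟨δ, hδ⟩ : ∃ δ, max (q.height - m) (max (q'.height - m) (q.height - m')) ≤ δ :=
    ⟨_, le_rfl⟩
  simp only [max_le_iff] at hδ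
  obtain ⟨hqm, hqm', hqm''⟩ := hδ
  have height_eq (x : T.Point) :
      (q'.ancestorAt (x.height + δ)).height = x.height + δ :=
    Point.height_ancestorAt_of_le (by linarith [hm x])
  refine ⟨δ, fun x => q'.ancestorAt (x.height + δ), IsGood.of_monotone
    (fun x y hxy => q'.ancestorAt_mono (by linarith [Point.height_mono hxy])) height_eq ?_ ?_⟩
  · intro u v huv
    have height_uv : u.height = v.height := by
      linarith [height_eq u, height_eq v, congrArg Point.height huv]
    have := Point.height_sup_le_max hq height_uv
    rcases le_max_iff.1 this with h | h <;> linarith [hm u, hm q]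
  · intro w hw u _
    have height_lt : w.height < q.height + δ := by
      by_contra! hle
      refine hw ⟨q.ancestorAt (w.height - δ), ?_⟩
      simp only [Point.height_ancestorAt_of_le (le_sub_iff_add_le.2 hle), sub_add_cancel]
      exact Point.ancestorAt_height (hq' w (by linarith [hm q]))
    linarith [hm' u]

theorem interleavingDist_le (h : IsGood δ α) : interleavingDist T T' ≤ δ :=
  csInf_le ⟨0, fun _ ⟨_, hα⟩ => hα.nonneg⟩ ⟨α, h⟩

theorem IsGood.of_frequently_le (hshift : ∀ x, (α x).height = x.height + δ)
    (h : ∃ᶠ δ' in 𝓝 δ, ∃ α' : T.Point → T'.Point, IsGood δ' α' ∧ ∀ x, α x ≤ α' x) :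
    IsGood δ α := by
  have mono : Monotone α := by
    intro x y hxy
    refine sup_eq_right.1 (Point.eq_of_le_of_height_eq le_sup_right (le_antisymm
      (Point.height_mono le_sup_right) (hshift y ▸ ?_))).symm
    refine ge_of_tendsto_of_frequently (tendsto_id.const_add y.height) (h.mono ?_)
    rintro δ' ⟨α', hα', hle⟩
    exact hα'.height_eq y ▸
      Point.height_mono (sup_le ((hle x).trans (hα'.monotone hxy)) (hle y))
  have tendsto_two_mul : Tendsto (fun δ' : ℝ => 2 * δ') (𝓝 δ) (𝓝 (2 * δ)) :=
    tendsto_id.const_mul 2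
  refine IsGood.of_monotone mono hshift (fun u v huv => ?_) fun w hw u hu => ?_
  · refine ge_of_tendsto_of_frequently tendsto_two_mul (h.mono ?_)
    rintro δ' ⟨α', hα', hle⟩
    refine hα'.height_sup_sub_height_le
      (Point.eq_of_le_of_le_of_height_eq (hle u) (huv ▸ hle v) ?_)
    have := congrArg Point.height huv
    rw [hα'.height_eq, hα'.height_eq]
    linarith [hshift u, hshift v]
  · refine ge_of_tendsto_of_frequently tendsto_two_mul (h.mono ?_)
    rintro δ' ⟨α', hα', hle⟩
    refine hα'.height_sub_height_le ?_ hu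
    rintro ⟨x, rfl⟩
    exact hw ⟨_, Point.apply_ancestorAt_of_monotone mono hshift (hle x)⟩

theorem exists_frequently_isGood_and_v_eq (T : MergeTree.{u}) (T' : MergeTree.{u'}) :
    ∃ e : {v : T.V // v ≠ T.root} → T'.V, ∃ᶠ δ' in 𝓝 (interleavingDist T T'),
      ∃ α' : T.Point → T'.Point, IsGood δ' α' ∧ ∀ v, (α' (T.vertexPoint v.1 v.2)).v = e v := by
  have := T.finite
  have := T'.finite
  obtain ⟨δ₀, α₀, hα₀⟩ := exists_isGood T T'
  have frequently_isGood : ∃ᶠ δ' in 𝓝 (interleavingDist T T'),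
      ∃ α' : T.Point → T'.Point, IsGood δ' α' :=
    mem_closure_iff_frequently.1
      (csInf_mem_closure ⟨δ₀, α₀, hα₀⟩ ⟨0, fun _ ⟨_, hα⟩ => hα.nonneg⟩)
  rw [← frequently_exists]
  exact frequently_isGood.mono fun δ' ⟨α', hα'⟩ => ⟨_, α', hα', fun _ => rfl⟩

theorem exists_isGood_interleavingDist (T : MergeTree.{u}) (T' : MergeTree.{u'}) :
    ∃ α : T.Point → T'.Point, IsGood (interleavingDist T T') α := by
  obtain ⟨e, he⟩ := exists_frequently_isGood_and_v_eq T T'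
  have exists_limit (v : {v : T.V // v ≠ T.root}) : ∃ y : T'.Point, y.v = e v ∧
      y.height = (T.vertexPoint v.1 v.2).height + interleavingDist T T' := by
    refine Point.exists_v_eq_and_height_eq
      ((tendsto_id.const_add (T.vertexPoint v.1 v.2).height).frequently (he.mono ?_))
    rintro δ' ⟨α', hα', hv⟩
    exact ⟨add_le_add_right (interleavingDist_le hα') _, _, hv v, hα'.height_eq _⟩
  choose β hβv hβ using exists_limit
  refine ⟨fun x => (β ⟨x.v, x.ne_root⟩).ancestorAt (x.height + interleavingDist T T'), ?_⟩
  have height_eq (x : T.Point) := Point.height_ancestorAt_of_le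
    ((hβ ⟨x.v, x.ne_root⟩).trans_le (add_le_add_left (Point.height_mono x.vertexPoint_v_le) _))
  refine IsGood.of_frequently_le height_eq (he.mono ?_)
  rintro δ' ⟨α', hα', hv⟩
  refine ⟨α', hα', fun x => ?_⟩
  have dist_le := interleavingDist_le hα'
  have β_le : β ⟨x.v, x.ne_root⟩ ≤ α' (T.vertexPoint x.v x.ne_root) :=
    Point.le_of_v_eq ((hβv _).trans (hv _).symm) (by rw [hβ, hα'.height_eq]; gcongr)
  refine Point.le_of_le_of_height_le (Point.le_ancestorAt _ _)
    (β_le.trans (hα'.monotone x.vertexPoint_v_le)) ?_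
  rw [height_eq, hα'.height_eq]
  gcongr

namespace IsGood

theorem isUpperSet_range (h : IsGood δ α) : IsUpperSet (Set.range α) := by
  rintro _ w hw ⟨x, rfl⟩
  exact ⟨_, h.apply_ancestorAt hw⟩

theorem exists_isLeast_range_inter_Ici (h : IsGood δ α) (y : T'.Point) :
    ∃ w, IsLeast (Set.range α ∩ Set.Ici y) w := by
  obtain ⟨p, -, hp⟩ := Set.exists_min_image _ (fun p => (y ⊔ α p).height) T.finite_vertexPoints
    T.nonempty_vertexPoints
  refine ⟨y ⊔ α p, ⟨h.isUpperSet_range le_sup_right ⟨p, rfl⟩, Set.mem_Ici.2 le_sup_left⟩, ?_⟩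
  rintro _ ⟨⟨x, rfl⟩, hyx⟩
  exact (Point.le_of_le_of_height_le le_sup_left le_sup_left
    (hp _ (vertexPoint_mem_vertexPoints x.v x.ne_root))).trans
      (sup_le hyx (h.monotone x.vertexPoint_v_le))

/-- The part of the ray above `y` that lies strictly below the least point `w` of the image is
outside the image, hence of depth at most `2 * δ`. -/
theorem height_sub_height_le_of_isLeast (h : IsGood δ α) {y w : T'.Point}
    (hw : IsLeast (Set.range α ∩ Set.Ici y) w) : w.height - y.height ≤ 2 * δ := by
  rw [sub_le_iff_le_add]
  refine le_of_forall_lt_imp_le_of_dense fun t ht => ?_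
  rcases le_total t y.height with hty | hyt
  · linarith [h.nonneg]
  · have height_eq := Point.height_ancestorAt_of_le hyt
    have notMem : y.ancestorAt t ∉ Set.range α := fun hmem =>
      (Point.height_mono (hw.2 ⟨hmem, y.le_ancestorAt t⟩)).not_gt (height_eq.trans_lt ht)
    linarith [h.height_sub_height_le notMem (y.le_ancestorAt t)]

/-- A point of `|T|` that is sent to the lowest ancestor of `y` in the image of `α`. The preimage is
chosen for that ancestor, and not for `y`, so that points with the same lowest ancestor in the image
have the same pullback. -/
noncomputable def pullback (h : IsGood δ α) (y : T'.Point) : T.Point :=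
  Function.invFun α (h.exists_isLeast_range_inter_Ici y).choose

theorem isLeast_apply_pullback (h : IsGood δ α) (y : T'.Point) :
    IsLeast (Set.range α ∩ Set.Ici y) (α (h.pullback y)) := by
  have hw := (h.exists_isLeast_range_inter_Ici y).choose_spec
  rwa [pullback, Function.invFun_eq hw.1.1]

theorem pullback_eq_of_le_of_notMem_range (h : IsGood δ α) {y z : T'.Point} (hyz : y ≤ z)
    (hz : z ∉ Set.range α) : h.pullback y = h.pullback z := by
  have hwy := (h.exists_isLeast_range_inter_Ici y).choose_spec
  have hwz := (h.exists_isLeast_range_inter_Ici z).choose_spec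
  refine congrArg (Function.invFun α) (le_antisymm (hwy.2 ⟨hwz.1.1, hyz.trans hwz.1.2⟩)
    (hwz.2 ⟨hwy.1.1, ?_⟩))
  exact (Point.le_total_of_le hwy.1.2 hyz).resolve_left
    fun hle => hz (h.isUpperSet_range hle hwy.1.1)

/-- The pairs of points that get the same label: `x` with its image, and `y` with its pullback. -/
def Corresponds (h : IsGood δ α) (x : T.Point) (y : T'.Point) : Prop :=
  y = α x ∨ x = h.pullback y

theorem Corresponds.isLeast {h : IsGood δ α} {x : T.Point} {y : T'.Point}
    (hxy : h.Corresponds x y) : IsLeast (Set.range α ∩ Set.Ici y) (α x) := by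
  rcases hxy with rfl | rfl
  · exact ⟨⟨⟨x, rfl⟩, Set.self_mem_Ici⟩, fun _ hw => hw.2⟩
  · exact h.isLeast_apply_pullback y

theorem Corresponds.eq_pullback {h : IsGood δ α} {x : T.Point} {y : T'.Point}
    (hxy : h.Corresponds x y) (hy : y ∉ Set.range α) : x = h.pullback y :=
  hxy.resolve_left fun hyx => hy ⟨x, hyx.symm⟩

theorem height_sup_le_of_le (h : IsGood δ α) {x x' : T.Point} {z : T'.Point} (hx : α x ≤ z)
    (hx' : α x' ≤ z) : (x ⊔ x').height ≤ z.height + δ := by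
  have fibre_le := h.height_sup_sub_height_le
    ((h.apply_ancestorAt hx).trans (h.apply_ancestorAt hx').symm)
  have height_le := h.height_eq x ▸ Point.height_mono hx
  rw [Point.height_ancestorAt_of_le (x := x) (by linarith)] at fibre_le
  linarith [Point.height_mono (sup_le_sup (x.le_ancestorAt (z.height - δ))
    (x'.le_ancestorAt (z.height - δ)))]

theorem Corresponds.abs_height_sup_sub_height_sup_le {h : IsGood δ α} {x x' : T.Point}
    {y y' : T'.Point} (hxy : h.Corresponds x y) (hxy' : h.Corresponds x' y') :
    |(x ⊔ x').height - (y ⊔ y').height| ≤ δ := by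
  have hw := hxy.isLeast
  have hw' := hxy'.isLeast
  refine abs_sub_le_iff.2 ⟨sub_le_iff_le_add'.2 ?_, sub_le_iff_le_add'.2 ?_⟩
  · by_cases hmem : y ⊔ y' ∈ Set.range α
    · exact h.height_sup_le_of_le (hw.2 ⟨hmem, Set.mem_Ici.2 le_sup_left⟩)
        (hw'.2 ⟨hmem, Set.mem_Ici.2 le_sup_right⟩)
    · have pullback_eq {z : T'.Point} (hz : z ≤ y ⊔ y') :
          z ∉ Set.range α ∧ h.pullback z = h.pullback (y ⊔ y') :=
        ⟨fun hz' => hmem (h.isUpperSet_range hz hz'), h.pullback_eq_of_le_of_notMem_range hz hmem⟩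
      obtain ⟨hy, pullback_y⟩ := pullback_eq (le_sup_left : y ≤ y ⊔ y')
      obtain ⟨hy', pullback_y'⟩ := pullback_eq (le_sup_right : y' ≤ y ⊔ y')
      have x_eq : x = x' := (hxy.eq_pullback hy).trans
        (pullback_y.trans (pullback_y'.symm.trans (hxy'.eq_pullback hy').symm))
      rw [← x_eq, sup_idem]
      linarith [h.height_eq x, h.height_sub_height_le_of_isLeast hw,
        Point.height_mono (le_sup_left : y ≤ y ⊔ y')]
  · rw [← h.height_eq]
    exact Point.height_mono (sup_le (hw.1.2.trans (h.monotone le_sup_left))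
      (hw'.1.2.trans (h.monotone le_sup_right)))

theorem exists_corresponds_families (h : IsGood δ α) :
    ∃ (n : ℕ) (p : Fin n → T.Point × T'.Point), (∀ i, h.Corresponds (p i).1 (p i).2) ∧
      (T.vertexPoints ⊆ Set.range fun i => (p i).1) ∧
      (T'.vertexPoints ⊆ Set.range fun i => (p i).2) ∧ ∃ i, (p i).2 = α (p i).1 := by
  obtain ⟨n, p, hp⟩ := (((T.finite_vertexPoints.image fun x => (x, α x)).union
    (T'.finite_vertexPoints.image fun y => (h.pullback y, y)))).fin_embedding
  have exists_eq {q : T.Point × T'.Point} (hq : q ∈ (fun x => (x, α x)) '' T.vertexPoints ∪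
      (fun y => (h.pullback y, y)) '' T'.vertexPoints) : ∃ i, p i = q := hp.ge hq
  refine ⟨n, p, fun i => ?_, fun x hx => ?_, fun y hy => ?_, ?_⟩
  · obtain ⟨x, -, hx⟩ | ⟨y, -, hy⟩ := hp.le ⟨i, rfl⟩
    · exact hx ▸ Or.inl rfl
    · exact hy ▸ Or.inr rfl
  · exact (exists_eq (Or.inl ⟨x, hx, rfl⟩)).imp fun i hi => congrArg Prod.fst hi
  · exact (exists_eq (Or.inr ⟨y, hy, rfl⟩)).imp fun i hi => congrArg Prod.snd hi
  · obtain ⟨x, hx⟩ := T.nonempty_vertexPoints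
    exact (exists_eq (Or.inl ⟨x, hx, rfl⟩)).imp fun i hi => by rw [hi]

end IsGood

end IsGood

section OfHeight

variable {β : Type u} [PartialOrder β] [Finite β]

/-- The merge tree of a finite order in which the elements above any given one form a chain: the
tree is the Hasse diagram, with a root of height `∞` added on top. -/
noncomputable def ofHeight (hchain : ∀ a : β, IsChain (· ≤ ·) (Set.Ici a))
    (htop : ∃ m : β, IsTop m) (h : β → ℝ) (hh : StrictMono h) : MergeTree.{u} where
  V := WithTop β
  G := SimpleGraph.hasse (WithTop β)
  root := ⊤
  f := WithTop.map h
  isTree := ⟨connected_hasse, isAcyclic_hasse_of_isChain_Ici (isChain_Ici_withTop hchain)⟩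
  adj_ne a b hab := by
    rcases SimpleGraph.hasse_adj.1 hab with hlt | hlt
    · exact (hh.withTop_map hlt.lt).ne
    · exact (hh.withTop_map hlt.lt).ne'
  exists_unique_higher a ha := by
    simp only [hasse_adj_and_lt_iff_covBy hh.withTop_map]
    exact existsUnique_covBy_of_isChain_Ici (isChain_Ici_withTop hchain a)
      (isMax_iff_eq_top.not.2 ha)
  root_degree := by
    obtain ⟨m, hm⟩ := htop
    rw [neighborSet_hasse_withTop_top hm, Set.ncard_singleton]
  eq_top_iff _ := WithTop.map_eq_top_iff

variable {hchain : ∀ a : β, IsChain (· ≤ ·) (Set.Ici a)} {htop : ∃ m : β, IsTop m} {h : β → ℝ}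
  {hh : StrictMono h}

theorem anc_ofHeight_iff {a b : WithTop β} : (ofHeight hchain htop h hh).Anc a b ↔ a ≤ b := by
  have := Fintype.ofFinite (WithTop β)
  classical
  have := Fintype.toLocallyFiniteOrder (α := WithTop β)
  rw [le_iff_reflTransGen_covBy]
  refine iff_of_eq (congrArg (Relation.ReflTransGen · a b) ?_)
  ext c d
  exact hasse_adj_and_lt_iff_covBy hh.withTop_map

theorem height_vertexPoint_sup_vertexPoint_ofHeight {a b c : β} (hc : IsLUB {a, b} c) :
    ((ofHeight hchain htop h hh).vertexPoint (a : WithTop β) WithTop.coe_ne_top ⊔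
      (ofHeight hchain htop h hh).vertexPoint (b : WithTop β) WithTop.coe_ne_top).height = h c := by
  have hac : (ofHeight hchain htop h hh).Anc (a : WithTop β) (c : WithTop β) :=
    anc_ofHeight_iff.2 (WithTop.coe_le_coe.2 (hc.1 (by simp)))
  have hbc : (ofHeight hchain htop h hh).Anc (b : WithTop β) (c : WithTop β) :=
    anc_ofHeight_iff.2 (WithTop.coe_le_coe.2 (hc.1 (by simp)))
  refine congrArg Point.height (Point.vertexPoint_sup_vertexPoint _ _ WithTop.coe_ne_top
    hac hbc fun d hd had hbd => ?_)
  obtain ⟨d, rfl⟩ := WithTop.ne_top_iff_exists.1 hd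
  refine anc_ofHeight_iff.2 (WithTop.coe_le_coe.2 (hc.2 ?_))
  rintro _ (rfl | rfl)
  · exact WithTop.coe_le_coe.1 (anc_ofHeight_iff.1 had)
  · exact WithTop.coe_le_coe.1 (anc_ofHeight_iff.1 hbd)

end OfHeight

section Subdivide

variable {P : Set T.Point}

open Classical in
/-- The embedding of the vertices of `T` into a set of points of `|T|` that contains all vertices of
finite height, with a top element added for the root. -/
noncomputable def vertexEmbedding (hP : T.vertexPoints ⊆ P) (v : T.V) : WithTop P :=
  if hv : v = T.root then ⊤ else
    ((⟨T.vertexPoint v hv, hP (vertexPoint_mem_vertexPoints v hv)⟩ : P) : WithTop P)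

variable {hP : T.vertexPoints ⊆ P}

theorem vertexEmbedding_root : vertexEmbedding hP T.root = ⊤ :=
  dif_pos rfl

theorem vertexEmbedding_of_ne_root {v : T.V} (hv : v ≠ T.root) : vertexEmbedding hP v =
    ((⟨T.vertexPoint v hv, hP (vertexPoint_mem_vertexPoints v hv)⟩ : P) : WithTop P) :=
  dif_neg hv

theorem vertexEmbedding_le_vertexEmbedding {v w : T.V} :
    vertexEmbedding hP v ≤ vertexEmbedding hP w ↔ T.Anc v w := by
  rcases eq_or_ne w T.root with rfl | hw
  · simp only [vertexEmbedding_root, le_top, T.anc_root v]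
  rcases eq_or_ne v T.root with rfl | hv
  · rw [vertexEmbedding_root, top_le_iff, vertexEmbedding_of_ne_root hw]
    exact iff_of_false WithTop.coe_ne_top fun h => hw ((T.anc_root w).antisymm h)
  · rw [vertexEmbedding_of_ne_root hv, vertexEmbedding_of_ne_root hw, WithTop.coe_le_coe]
    exact Point.vertexPoint_le_vertexPoint

theorem vertexEmbedding_injective : Function.Injective (vertexEmbedding hP) := fun _ _ h =>
  (vertexEmbedding_le_vertexEmbedding.1 h.le).antisymm (vertexEmbedding_le_vertexEmbedding.1 h.ge)

theorem map_height_vertexEmbedding (v : T.V) :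
    (vertexEmbedding hP v).map (fun x => x.1.height) = T.f v := by
  rcases eq_or_ne v T.root with rfl | hv
  · rw [vertexEmbedding_root, WithTop.map_top, (T.eq_top_iff _).2 rfl]
  · rw [vertexEmbedding_of_ne_root hv, WithTop.map_coe, Point.coe_height_vertexPoint]

theorem coe_mem_range_vertexEmbedding {x : P} (hx : x.1 ∈ T.vertexPoints) :
    (x : WithTop P) ∈ Set.range (vertexEmbedding hP) := by
  obtain ⟨⟨v, hv⟩, hvx⟩ := hx
  exact ⟨v, (vertexEmbedding_of_ne_root hv).trans (congrArg _ (Subtype.ext hvx))⟩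

theorem isChain_Ici_coe (x : P) : IsChain (· ≤ ·) (Set.Ici x) :=
  fun _ hy _ hz _ => Point.le_total_of_le (Subtype.coe_le_coe.2 hy) (Subtype.coe_le_coe.2 hz)

theorem existsUnique_covBy_coe [Finite P] (hP : T.vertexPoints ⊆ P) {x : P}
    (hx : x.1 ∉ T.vertexPoints) : ∃! b : WithTop P, b ⋖ (x : WithTop P) := by
  have hv := vertexPoint_mem_vertexPoints x.1.v x.1.ne_root
  refine existsUnique_covBy_of_forall_lt_le_or_le
    (y := ((⟨T.vertexPoint x.1.v x.1.ne_root, hP hv⟩ : P) : WithTop P))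
    (isChain_Ici_withTop isChain_Ici_coe _) (WithTop.coe_lt_coe.2 ?_) fun c hc => ?_
  · exact x.1.vertexPoint_v_le.lt_of_ne fun h => hx (h ▸ hv)
  · obtain ⟨c, rfl⟩ := WithTop.ne_top_iff_exists.1 hc.ne_top
    rw [WithTop.coe_le_coe, WithTop.coe_le_coe]
    exact Point.le_vertexPoint_v_or_vertexPoint_v_le (WithTop.coe_lt_coe.1 hc).le

theorem exists_isTop_coe [Finite P] (hP : T.vertexPoints ⊆ P) : ∃ m : P, IsTop m := by
  obtain ⟨m, hm, hle⟩ := exists_isGreatest_of_supClosed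
    (Point.supClosed_of_vertexPoints_subset hP) P.toFinite (T.nonempty_vertexPoints.mono hP)
  exact ⟨⟨m, hm⟩, fun x => hle x.2⟩

/-- The merge tree whose vertices of finite height are the points in a finite set that contains all
vertices of finite height of `T`. -/
noncomputable def subdivide (T : MergeTree.{u}) (P : Set T.Point) [Finite P]
    (hP : T.vertexPoints ⊆ P) : MergeTree.{u} :=
  ofHeight isChain_Ici_coe (exists_isTop_coe hP) (fun x : P => x.1.height)
    (Point.height_strictMono.comp (Subtype.strictMono_coe _))

theorem isSubdivision_subdivide [Finite P] (hP : T.vertexPoints ⊆ P) :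
    (T.subdivide P hP).IsSubdivision T := by
  refine ⟨vertexEmbedding hP, vertexEmbedding_injective, map_height_vertexEmbedding,
    fun v w => anc_ofHeight_iff.trans vertexEmbedding_le_vertexEmbedding, fun s hs => ?_⟩
  obtain ⟨x, rfl⟩ : ∃ x : P, (x : WithTop P) = s :=
    WithTop.ne_top_iff_exists.1 fun h => hs ⟨T.root, vertexEmbedding_root.trans h.symm⟩
  exact ncard_neighborSet_hasse_eq_two
    (existsUnique_covBy_of_isChain_Ici (isChain_Ici_withTop isChain_Ici_coe _)
      (isMax_iff_eq_top.not.2 WithTop.coe_ne_top))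
    (existsUnique_covBy_coe hP fun hx => hs (coe_mem_range_vertexEmbedding hx))

theorem exists_labeling_subdivide {n : ℕ} (x : Fin n → T.Point)
    (hx : T.vertexPoints ⊆ Set.range x) : ∃ π : (T.subdivide (Set.range x) hx).Labeling n,
      ∀ i j, (T.subdivide (Set.range x) hx).inducedMatrix π i j = (x i ⊔ x j).height := by
  have supClosed := Point.supClosed_of_vertexPoints_subset hx
  refine ⟨{
    toFun := fun i => ((⟨x i, i, rfl⟩ : Set.range x) : WithTop (Set.range x))
    ne_root := fun i => WithTop.coe_ne_top
    surj_leaf := fun v hv => ?_ }, fun i j => ?_⟩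
  · obtain ⟨⟨_, i, rfl⟩, hi⟩ := WithTop.ne_top_iff_exists.1 hv.1
    exact ⟨i, hi⟩
  · refine height_vertexPoint_sup_vertexPoint_ofHeight
      (c := (⟨x i ⊔ x j, supClosed ⟨i, rfl⟩ ⟨j, rfl⟩⟩ : Set.range x)) ⟨?_, fun y hy => ?_⟩
    · rintro _ (rfl | rfl)
      exacts [le_sup_left (a := x i), le_sup_right (a := x i)]
    · exact sup_le (Subtype.coe_le_coe.2 (hy (Set.mem_insert _ _)))
        (Subtype.coe_le_coe.2 (hy (Set.mem_insert_of_mem _ rfl)))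

variable {T' : MergeTree.{u'}} {δ : ℝ} {α : T.Point → T'.Point}

theorem IsGood.exists_subdivision_labeledInterleavingDist_eq (h : IsGood δ α) :
    ∃ (n : ℕ) (S : MergeTree.{u}) (S' : MergeTree.{u'}) (π : S.Labeling n) (π' : S'.Labeling n),
      S.IsSubdivision T ∧ S'.IsSubdivision T' ∧ δ = labeledInterleavingDist S S' π π' := by
  obtain ⟨n, p, hp, hT, hT', i, hi⟩ := h.exists_corresponds_families
  obtain ⟨π, hπ⟩ := exists_labeling_subdivide _ hT
  obtain ⟨π', hπ'⟩ := exists_labeling_subdivide _ hT'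
  refine ⟨n, _, _, π, π', isSubdivision_subdivide hT, isSubdivision_subdivide hT',
    le_antisymm ?_ ((pi_norm_le_iff_of_nonneg h.nonneg).2 fun q => ?_)⟩
  · refine le_trans (le_of_eq ?_) (norm_le_pi_norm _ (i, i))
    rw [hπ, hπ', sup_idem, sup_idem, hi, h.height_eq, sub_add_cancel_left, norm_neg,
      Real.norm_of_nonneg h.nonneg]
  · rw [hπ, hπ']
    exact (hp q.1).abs_height_sup_sub_height_sup_le (hp q.2)

end Subdivide

end MergeTree

theorem mainTheorem3 (T : MergeTree.{u}) (T' : MergeTree.{u'}) :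
    (∃ (n : ℕ) (S : MergeTree.{u}) (S' : MergeTree.{u'}) (π : S.Labeling n) (π' : S'.Labeling n),
      S.IsSubdivision T ∧ S'.IsSubdivision T' ∧
      MergeTree.interleavingDist T T' = MergeTree.labeledInterleavingDist S S' π π') ∧
    ∃ α : T.Point → T'.Point, MergeTree.IsGood (MergeTree.interleavingDist T T') α := by
  obtain ⟨α, hα⟩ := MergeTree.exists_isGood_interleavingDist T T'
  exact ⟨hα.exists_subdivision_labeledInterleavingDist_eq, α, hα⟩
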